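/- Throughout, $k$ is a field of characteristic zero, and all rings are associative unital $k$-algebras. **Definitions.** A ring $A\neq 0$ is *prime* if $aAb=0$ implies $a=0$ or $b=0$. It is *left Goldie* if it contains no infinite direct sum of nonzero left ideals and satisfies the ascending chain condition on left annihilators of subsets; it is *Goldie* if both it and its opposite ring are left Goldie. A *subframe* of $A$ is a finite-dimensional $k$-subspace $V\subseteq A$ with $1\in V$. The Gelfand–Kirillov dimension is $$\operatorname{GK} A=\sup_V\limsup_{n\to\infty}\frac{\log\dim_k V^n}{\log n}\in[0,\infty],$$ with $V$ ranging over all subframes. For a real number $d>0$, a subframe $V$ satisfies $VDI(A)_d$ if there is $c>0$ with $$\dim_k VW\ \ge\ \dim_k W+c\,(\dim_k W)^{(d-1)/d}$$ for every nonzero finite-dimensional subspace $W\subseteq A$, and it satisfies $VDI(A)_\infty$ if there is $c>0$ with $\dim_k VW\ge \dim_k W+c\dim_k W$ for all such $W$. The *lower transcendence degree* $LD\,A\in[0,\infty]$ is $0$ if for every subframe $V$ there is a nonzero finite-dimensional subspace $W\subseteq A$ with $\dim_k VW=\dim_k W$; otherwise $$LD\,A=\sup_V\,\sup\{d\in(0,\infty]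 : V \text{ satisfies } VDI(A)_d\},$$ with $V$ ranging over all subframes. The algebra $A$ is *$LD$-stable* if $LD\,A=\operatorname{GK}A$. A *Morita context* between $R$ and $S$ consists of an $R$-$S$-bimodule $V$ and an $S$-$R$-bimodule $W$ (on each of which $k$ acts in the same way from both sides), together with bimodule maps $V\otimes_S W\to R$ and $W\otimes_R V\to S$, written as products, such that $(vw)v'=v(wv')$ and $(wv)w'=w(vw')$ for all $v,v'\in V$, $w,w'\in W$; equivalently, such that $\begin{bmatrix}R&V\\W&S\end{bmatrix}$ is a $k$-algebra. For prime rings $R$ and $S$ it is a *prime context* if for all nonzero $v\in V$, $w\in W$, $s\in S$, the sets $vW$, $Vw$ and $VsW$ are nonzero. $R$ and $S$ are *Morita equivalent* if their categories of modules are equivalent as $k$-linear categories. **Theorem 7.5.** Let $R$ and $S$ be prime Goldie $k$-algebras. 1. If there is a prime context between $R$ and $S$, then $LD\,R=LD\,S$. 2. If $R$ and $S$ are Morita equivalent, then $LD\,R=LD\,S$ and $\operatorname{GK}R=\operatorname{GK}S$; in particular, $R$ is $LD$-stable if and only if $S$ is $LD$-stable. -/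

import Mathlib

open scoped ENNReal

/-! ### Prime Goldie rings -/

/-- A prime ring: a nonzero ring in which `a R b = 0` forces `a = 0` or `b = 0`. -/
structure IsPrimeRing (R : Type*) [Ring R] : Prop where
  nontrivial : Nontrivial R
  eq_zero_or_eq_zero : ∀ a b : R, (∀ r : R, a * r * b = 0) → a = 0 ∨ b = 0

/-- The left annihilator of a subset of a ring. -/
def leftAnnihilator {R : Type*} [Ring R] (X : Set R) : Set R :=
  {r | ∀ x ∈ X, r * x = 0}

/-- A left Goldie ring: finite left uniform dimension (there is no infinite direct sum of nonzero
left ideals) and the ascending chain condition on left annihilators. -/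
structure IsLeftGoldie (R : Type*) [Ring R] : Prop where
  finite_uniform_dim : ¬ ∃ I : ℕ → Ideal R, iSupIndep I ∧ ∀ n, I n ≠ ⊥
  acc_annihilators : ∀ X : ℕ → Set R, Monotone (fun n => leftAnnihilator (X n)) →
    ∃ n, ∀ m, n ≤ m → leftAnnihilator (X m) = leftAnnihilator (X n)

/-- A (two-sided) Goldie ring: left Goldie and right Goldie, the latter being left Goldie for the
opposite ring. -/
structure IsGoldie (R : Type*) [Ring R] : Prop where
  left : IsLeftGoldie R
  right : IsLeftGoldie Rᵐᵒᵖ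

/-! ### Gelfand–Kirillov dimension and lower transcendence degree -/

/-- A subframe of the `k`-algebra `A`: a finite dimensional subspace containing `1`. -/
structure IsSubframe (k : Type*) {A : Type*} [Field k] [Ring A] [Algebra k A]
    (V : Submodule k A) : Prop where
  finite : FiniteDimensional k V
  one_mem : (1 : A) ∈ V

/-- The Gelfand–Kirillov dimension `sup_V limsup_n log (dim V ^ n) / log n` over all subframes `V`,
with values in `[0, ∞]`. (The quotient is nonnegative, so `ENNReal.ofReal` does not truncate.) -/
noncomputable def gkDim (k A : Type*) [Field k] [Ring A] [Algebra k A] : ℝ≥0∞ :=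
  ⨆ (V : Submodule k A) (_ : IsSubframe k V),
    Filter.limsup (fun n : ℕ =>
      ENNReal.ofReal (Real.log (Module.finrank k (V ^ n : Submodule k A)) / Real.log n))
      Filter.atTop

/-- The volume difference inequality `VDI(A)_d` for a real number `d` (used only for `d > 0`). -/
def VDI (k : Type*) {A : Type*} [Field k] [Ring A] [Algebra k A] (V : Submodule k A) (d : ℝ) :
    Prop :=
  ∃ c : ℝ, 0 < c ∧ ∀ W : Submodule k A, W ≠ ⊥ → FiniteDimensional k W →
    (Module.finrank k W : ℝ) + c * (Module.finrank k W : ℝ) ^ ((d - 1) / d) ≤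
      (Module.finrank k (V * W : Submodule k A) : ℝ)

/-- The volume difference inequality `VDI(A)_∞`. -/
def VDITop (k : Type*) {A : Type*} [Field k] [Ring A] [Algebra k A] (V : Submodule k A) : Prop :=
  ∃ c : ℝ, 0 < c ∧ ∀ W : Submodule k A, W ≠ ⊥ → FiniteDimensional k W →
    (Module.finrank k W : ℝ) + c * (Module.finrank k W : ℝ) ≤
      (Module.finrank k (V * W : Submodule k A) : ℝ)

open Classical in
/-- The lower transcendence degree of a `k`-algebra, with values in `[0, ∞]`. -/
noncomputable def lowerTrdeg (k A : Type*) [Field k] [Ring A] [Algebra k A] : ℝ≥0∞ :=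
  if ∀ V : Submodule k A, IsSubframe k V → ∃ W : Submodule k A, W ≠ ⊥ ∧ FiniteDimensional k W ∧
      Module.finrank k (V * W : Submodule k A) = Module.finrank k W then 0
  else
    ⨆ (V : Submodule k A) (_ : IsSubframe k V),
      sSup {d : ℝ≥0∞ | (∃ x : ℝ, 0 < x ∧ d = ENNReal.ofReal x ∧ VDI k V x) ∨
        (d = ⊤ ∧ VDITop k V)}

/-- `A` is `LD`-stable if its lower transcendence degree equals its Gelfand–Kirillov dimension. -/
def IsLDStable (k A : Type*) [Field k] [Ring A] [Algebra k A] : Prop :=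
  lowerTrdeg k A = gkDim k A

/-! ### Morita contexts -/

open MulOpposite in
/-- A Morita context between the `k`-algebras `R` and `S`: an `R`-`S`-bimodule `V` and an
`S`-`R`-bimodule `W`, on which the two induced actions of `k` agree, with products `V × W → R` and
`W × V → S` that make the matrices `[R, V; W, S]` into a `k`-algebra. Equivalently, the products are
bimodule maps `V ⊗[S] W → R` and `W ⊗[R] V → S` satisfying the two associativity laws. Right
actions are written as actions of the opposite rings. -/
structure MoritaContext (k R S V W : Type*) [Field k] [Ring R] [Algebra k R] [Ring S] [Algebra k S]
    [AddCommGroup V] [Module k V] [Module R V] [Module Sᵐᵒᵖ V] [SMulCommClass R Sᵐᵒᵖ V]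
    [IsScalarTower k R V] [IsScalarTower k Sᵐᵒᵖ V]
    [AddCommGroup W] [Module k W] [Module S W] [Module Rᵐᵒᵖ W] [SMulCommClass S Rᵐᵒᵖ W]
    [IsScalarTower k S W] [IsScalarTower k Rᵐᵒᵖ W] where
  /-- the product `V × W → R` -/
  vw : V →ₗ[k] W →ₗ[k] R
  /-- the product `W × V → S` -/
  wv : W →ₗ[k] V →ₗ[k] S
  smul_vw : ∀ (r : R) (v : V) (w : W), vw (r • v) w = r * vw v w
  vw_smul : ∀ (v : V) (w : W) (r : R), vw v (op r • w) = vw v w * r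
  vw_balanced : ∀ (v : V) (s : S) (w : W), vw (op s • v) w = vw v (s • w)
  smul_wv : ∀ (s : S) (w : W) (v : V), wv (s • w) v = s * wv w v
  wv_smul : ∀ (w : W) (v : V) (s : S), wv w (op s • v) = wv w v * s
  wv_balanced : ∀ (w : W) (r : R) (v : V), wv (op r • w) v = wv w (r • v)
  vw_assoc : ∀ (v : V) (w : W) (v' : V), vw v w • v' = op (wv w v') • v
  wv_assoc : ∀ (w : W) (v : V) (w' : W), wv w v • w' = op (vw v w') • w

/-- A prime context between the prime rings `R` and `S`: a Morita context in which `vW`, `Vw` and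
`VsW` are nonzero for all nonzero `v ∈ V`, `w ∈ W`, `s ∈ S`. -/
structure MoritaContext.IsPrime {k R S V W : Type*} [Field k] [Ring R] [Algebra k R] [Ring S]
    [Algebra k S]
    [AddCommGroup V] [Module k V] [Module R V] [Module Sᵐᵒᵖ V] [SMulCommClass R Sᵐᵒᵖ V]
    [IsScalarTower k R V] [IsScalarTower k Sᵐᵒᵖ V]
    [AddCommGroup W] [Module k W] [Module S W] [Module Rᵐᵒᵖ W] [SMulCommClass S Rᵐᵒᵖ W]
    [IsScalarTower k S W] [IsScalarTower k Rᵐᵒᵖ W] (C : MoritaContext k R S V W) : Prop where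
  prime_left : IsPrimeRing R
  prime_right : IsPrimeRing S
  vW_ne_zero : ∀ v : V, v ≠ 0 → ∃ w : W, C.vw v w ≠ 0
  Vw_ne_zero : ∀ w : W, w ≠ 0 → ∃ v : V, C.vw v w ≠ 0
  VsW_ne_zero : ∀ s : S, s ≠ 0 → ∃ (v : V) (w : W), C.vw v (s • w) ≠ 0

/-!
For a simple ring `R = Mₙ(D)` the volume of `W ⊆ R` is counted by splitting `W` into `n²` pieces in
`D`, and a volume difference inequality passes between `D` and `R` because the dimension counts are
exact on both sides. The proof below does the same for a prime context `[R, M; N, S]` of prime Goldie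
rings without forming quotient rings.

Let `U ⊆ S` be a minimal nonzero right annihilator. Left multiplication by an element of `S` is zero
or injective on `U`, so `U` behaves like a simple right ideal, and a maximality argument yields, for
`X = S` and for `X = M`, a number `t` and injective right `S`-linear maps `X → U ^ t → X` given by
left multiplications (`BilinearContext.Nondegenerate.exists_dual_system`). If `p` and `q` are the
numbers belonging to `S` and to `M`, there result injective maps `S ^ q → M ^ p → S ^ q` given by
matrices over `M` and `N` (`exists_matrices`). On the other side `M` embeds as a left `R`-module into
some `R ^ t` (`exists_finite_separating`), and filtering a subspace of `R ^ t` by its coordinates shows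
that an inequality for `R` holds for `M ^ p` with the same exponent
(`VolumeDifference.exists_of_embedding`). Given `W ⊆ S`, move `W ^ q` to `Z ⊆ M ^ p`, multiply by `V`,
and move `V Z` back: it lands in `(V' W) ^ q` for a finite dimensional `V' ⊆ S` independent of `W`, and
since nothing is lost in the leading term, `V'` satisfies the inequality for `S`
(`exists_volumeDifference`). By symmetry the lower transcendence degrees agree.

A Morita equivalence `e` gives a context with `M = Hom(R, Q)` and `N = Hom(Q, R)`, where `Q` is the
`R`-module that corresponds to `S`; both products are onto because the trace ideals of `Q` and of
`e(R)` are everything (`exists_sum_comp_eq_id_of_separating`), so it is nondegenerate. If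
`1 = ∑ mᵢ nᵢ` in `R`, then `V ^ l` embeds into `(V' ^ l) ^ (t * t)` for the span `V'` of `1` and the
`nᵢ V mⱼ` (`BilinearContext.finrank_pow_le`), and the bounded factor `t * t` does not affect
Gelfand–Kirillov dimension.
-/

/-! ### Morita contexts as bilinear data -/

/-- A Morita context between `R` and `S`, in a form symmetric in the two rings: two `k`-spaces `M`
and `N` with the six products `R × M → M`, `M × S → M`, `S × N → N`, `N × R → N`, `M × N → R`,
`N × M → S` of the matrix ring `[R, M; N, S]`, all of them `k`-bilinear, unital and associative.
The product of an element of `X` and an element of `Y` is called `xy`, and `x_y_z` is the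
associativity law for a triple of elements of `X`, `Y`, `Z`. Bilinear maps take the place of module
structures because on the objects used below (morphism spaces, and `S` itself) instances would
be in the way. -/
structure BilinearContext (k R S M N : Type*) [Field k] [Ring R] [Algebra k R] [Ring S]
    [Algebra k S] [AddCommGroup M] [Module k M] [AddCommGroup N] [Module k N] where
  rm : R →ₗ[k] M →ₗ[k] M
  ms : M →ₗ[k] S →ₗ[k] M
  sn : S →ₗ[k] N →ₗ[k] N
  nr : N →ₗ[k] R →ₗ[k] N
  mn : M →ₗ[k] N →ₗ[k] R
  nm : N →ₗ[k] M →ₗ[k] S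
  one_m : ∀ m, rm 1 m = m
  m_one : ∀ m, ms m 1 = m
  one_n : ∀ n, sn 1 n = n
  n_one : ∀ n, nr n 1 = n
  r_r_m : ∀ r r' m, rm (r * r') m = rm r (rm r' m)
  r_m_s : ∀ r m s, ms (rm r m) s = rm r (ms m s)
  m_s_s : ∀ m s s', ms (ms m s) s' = ms m (s * s')
  s_s_n : ∀ s s' n, sn (s * s') n = sn s (sn s' n)
  s_n_r : ∀ s n r, nr (sn s n) r = sn s (nr n r)
  n_r_r : ∀ n r r', nr (nr n r) r' = nr n (r * r')
  r_m_n : ∀ r m n, mn (rm r m) n = r * mn m n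
  m_s_n : ∀ m s n, mn (ms m s) n = mn m (sn s n)
  m_n_r : ∀ m n r, mn m n * r = mn m (nr n r)
  s_n_m : ∀ s n m, nm (sn s n) m = s * nm n m
  n_r_m : ∀ n r m, nm (nr n r) m = nm n (rm r m)
  n_m_s : ∀ n m s, nm n m * s = nm n (ms m s)
  m_n_m : ∀ m n m', rm (mn m n) m' = ms m (nm n m')
  n_m_n : ∀ n m n', sn (nm n m) n' = nr n (mn m n')

namespace BilinearContext

variable {k R S M N : Type*} [Field k] [Ring R] [Algebra k R] [Ring S] [Algebra k S]
  [AddCommGroup M] [Module k M] [AddCommGroup N] [Module k N]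

/-- The same context, read as a context between `S` and `R`. -/
def swap (C : BilinearContext k R S M N) : BilinearContext k S R N M where
  rm := C.sn
  ms := C.nr
  sn := C.rm
  nr := C.ms
  mn := C.nm
  nm := C.mn
  one_m := C.one_n
  m_one := C.n_one
  one_n := C.one_m
  n_one := C.m_one
  r_r_m := C.s_s_n
  r_m_s := C.s_n_r
  m_s_s := C.n_r_r
  s_s_n := C.r_r_m
  s_n_r := C.r_m_s
  n_r_r := C.m_s_s
  r_m_n := C.s_n_m
  m_s_n := C.n_r_m
  m_n_r := C.n_m_s
  s_n_m := C.r_m_n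
  n_r_m := C.m_s_n
  n_m_s := C.m_n_r
  m_n_m := C.n_m_n
  n_m_n := C.m_n_m

variable (k S) in
/-- The trivial context between `S` and itself. -/
def self : BilinearContext k S S S S where
  rm := LinearMap.mul k S
  ms := LinearMap.mul k S
  sn := LinearMap.mul k S
  nr := LinearMap.mul k S
  mn := LinearMap.mul k S
  nm := LinearMap.mul k S
  one_m := one_mul
  m_one := mul_one
  one_n := one_mul
  n_one := mul_one
  r_r_m := mul_assoc
  r_m_s := mul_assoc
  m_s_s := mul_assoc
  s_s_n := mul_assoc
  s_n_r := mul_assoc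
  n_r_r := mul_assoc
  r_m_n := mul_assoc
  m_s_n := mul_assoc
  m_n_r := mul_assoc
  s_n_m := mul_assoc
  n_r_m := mul_assoc
  n_m_s := mul_assoc
  m_n_m := mul_assoc
  n_m_n := mul_assoc

/-- The cancellation properties that hold in prime contexts. In contrast to
`MoritaContext.IsPrime` they are symmetric in the two rings. -/
structure Nondegenerate (C : BilinearContext k R S M N) : Prop where
  eq_zero_of_mn_left : ∀ m, (∀ n, C.mn m n = 0) → m = 0
  eq_zero_of_mn_right : ∀ n, (∀ m, C.mn m n = 0) → n = 0
  eq_zero_of_nm_left : ∀ n, (∀ m, C.nm n m = 0) → n = 0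
  eq_zero_of_nm_right : ∀ m, (∀ n, C.nm n m = 0) → m = 0
  eq_zero_of_rm : ∀ r, (∀ m, C.rm r m = 0) → r = 0
  eq_zero_of_sn : ∀ s, (∀ n, C.sn s n = 0) → s = 0

variable {C : BilinearContext k R S M N}

theorem Nondegenerate.swap (hC : C.Nondegenerate) : C.swap.Nondegenerate :=
  ⟨hC.eq_zero_of_nm_left, hC.eq_zero_of_nm_right, hC.eq_zero_of_mn_left, hC.eq_zero_of_mn_right,
    hC.eq_zero_of_sn, hC.eq_zero_of_rm⟩

theorem nondegenerate_self : (self k S).Nondegenerate where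
  eq_zero_of_mn_left m h := by simpa [self] using h 1
  eq_zero_of_mn_right n h := by simpa [self] using h 1
  eq_zero_of_nm_left n h := by simpa [self] using h 1
  eq_zero_of_nm_right m h := by simpa [self] using h 1
  eq_zero_of_rm r h := by simpa [self] using h 1
  eq_zero_of_sn s h := by simpa [self] using h 1

/-- A context in which both products are onto is nondegenerate. -/
theorem nondegenerate_of_sum_eq_one {p q : ℕ} (m : Fin p → M) (n : Fin p → N)
    (hmn : ∑ i, C.mn (m i) (n i) = 1) (n' : Fin q → N) (m' : Fin q → M)
    (hnm : ∑ i, C.nm (n' i) (m' i) = 1) : C.Nondegenerate where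
  eq_zero_of_mn_left x h := by
    rw [← C.m_one x, ← hnm, map_sum]
    exact Finset.sum_eq_zero fun i _ => by rw [← C.m_n_m, h, map_zero, LinearMap.zero_apply]
  eq_zero_of_mn_right x h := by
    rw [← C.one_n x, ← hnm, map_sum, LinearMap.sum_apply]
    exact Finset.sum_eq_zero fun i _ => by rw [C.n_m_n, h, map_zero]
  eq_zero_of_nm_left x h := by
    rw [← C.n_one x, ← hmn, map_sum]
    exact Finset.sum_eq_zero fun i _ => by rw [← C.n_m_n, h, map_zero, LinearMap.zero_apply]
  eq_zero_of_nm_right x h := by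
    rw [← C.one_m x, ← hmn, map_sum, LinearMap.sum_apply]
    exact Finset.sum_eq_zero fun i _ => by rw [C.m_n_m, h, map_zero]
  eq_zero_of_rm x h := by
    rw [← mul_one x, ← hmn, Finset.mul_sum]
    exact Finset.sum_eq_zero fun i _ => by rw [← C.r_m_n, h, map_zero, LinearMap.zero_apply]
  eq_zero_of_sn x h := by
    rw [← mul_one x, ← hnm, Finset.mul_sum]
    exact Finset.sum_eq_zero fun i _ => by rw [← C.s_n_m, h, map_zero, LinearMap.zero_apply]

end BilinearContext

namespace MoritaContext

variable {k R S V W : Type*} [Field k] [Ring R] [Algebra k R] [Ring S] [Algebra k S]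
  [AddCommGroup V] [Module k V] [Module R V] [Module Sᵐᵒᵖ V] [SMulCommClass R Sᵐᵒᵖ V]
  [IsScalarTower k R V] [IsScalarTower k Sᵐᵒᵖ V]
  [AddCommGroup W] [Module k W] [Module S W] [Module Rᵐᵒᵖ W] [SMulCommClass S Rᵐᵒᵖ W]
  [IsScalarTower k S W] [IsScalarTower k Rᵐᵒᵖ W]

open MulOpposite in
/-- The bilinear data of a Morita context. -/
def toBilinearContext (C : MoritaContext k R S V W) : BilinearContext k R S V W where
  rm := (Algebra.lsmul k k V).toLinearMap
  ms := ((Algebra.lsmul k k V).toLinearMap ∘ₗ (opLinearEquiv k : S ≃ₗ[k] Sᵐᵒᵖ).toLinearMap).flip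
  sn := (Algebra.lsmul k k W).toLinearMap
  nr := ((Algebra.lsmul k k W).toLinearMap ∘ₗ (opLinearEquiv k : R ≃ₗ[k] Rᵐᵒᵖ).toLinearMap).flip
  mn := C.vw
  nm := C.wv
  one_m := one_smul R
  m_one := one_smul Sᵐᵒᵖ
  one_n := one_smul S
  n_one := one_smul Rᵐᵒᵖ
  r_r_m := mul_smul
  r_m_s r m s := (smul_comm r (op s) m).symm
  m_s_s m s s' := (mul_smul (op s') (op s) m).symm
  s_s_n := mul_smul
  s_n_r s n r := (smul_comm s (op r) n).symm
  n_r_r n r r' := (mul_smul (op r') (op r) n).symm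
  r_m_n := C.smul_vw
  m_s_n := C.vw_balanced
  m_n_r m n r := (C.vw_smul m n r).symm
  s_n_m := C.smul_wv
  n_r_m := C.wv_balanced
  n_m_s n m s := (C.wv_smul n m s).symm
  m_n_m := C.vw_assoc
  n_m_n := C.wv_assoc

theorem IsPrime.nondegenerate {C : MoritaContext k R S V W} (hC : C.IsPrime) :
    C.toBilinearContext.Nondegenerate := by
  set B := C.toBilinearContext
  have hvW : ∀ v, (∀ w, B.mn v w = 0) → v = 0 := fun v h => by
    by_contra hv
    obtain ⟨w, hw⟩ := hC.vW_ne_zero v hv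
    exact hw (h w)
  have hVw : ∀ w, (∀ v, B.mn v w = 0) → w = 0 := fun w h => by
    by_contra hw
    obtain ⟨v, hv⟩ := hC.Vw_ne_zero w hw
    exact hv (h v)
  have hVsW : ∀ s, (∀ v w, B.mn v (B.sn s w) = 0) → s = 0 := fun s h => by
    by_contra hs
    obtain ⟨v, w, hvw⟩ := hC.VsW_ne_zero s hs
    exact hvw (h v w)
  -- The ideal `VW` of `R` is nonzero, hence has zero left annihilator.
  have hr : ∀ r, (∀ v w, r * B.mn v w = 0) → r = 0 := fun r h => by
    have := hC.prime_right.nontrivial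
    obtain ⟨v, w, hvw⟩ := hC.VsW_ne_zero 1 one_ne_zero
    refine (hC.prime_left.eq_zero_or_eq_zero r _ fun x => ?_).resolve_right hvw
    have := h (B.rm x v) (B.sn 1 w)
    rw [B.r_m_n, ← mul_assoc] at this
    exact this
  refine ⟨hvW, hVw, fun w h => ?_, fun v h => ?_, fun r h => ?_, fun s h => ?_⟩
  · refine hVw w fun v => hr _ fun v' w' => ?_
    rw [B.m_n_r, ← B.n_m_n, h, map_zero, LinearMap.zero_apply, map_zero]
  · refine hvW v fun w => ?_
    -- `(v' w') (v w) = v' (w' v) w = 0`, so `v w` has nonzero left annihilator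
    have hz : ∀ v' w', B.mn v' w' * B.mn v w = 0 := fun v' w' => by
      rw [B.m_n_r, ← B.n_m_n, h, map_zero, LinearMap.zero_apply, map_zero]
    have := hC.prime_right.nontrivial
    obtain ⟨v', w', hvw⟩ := hC.VsW_ne_zero 1 one_ne_zero
    refine (hC.prime_left.eq_zero_or_eq_zero _ _ fun x => ?_).resolve_left hvw
    have := hz v' (B.nr (B.sn 1 w') x)
    rw [← B.m_n_r] at this
    exact this
  · exact hr r fun v w => by rw [← B.r_m_n, h, map_zero, LinearMap.zero_apply]
  · exact hVsW s fun v w => by rw [h, map_zero]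

end MoritaContext

/-! ### Minimal annihilators -/

/-- The right annihilator of a subset of a ring. -/
def rightAnnihilator {R : Type*} [Ring R] (X : Set R) : Set R :=
  {r | ∀ x ∈ X, x * r = 0}

/-- The ascending chain condition on left annihilators is the descending chain condition on right
annihilators: every nonempty family of right annihilators has a minimal member. -/
theorem IsLeftGoldie.exists_minimal_rightAnnihilator {R : Type*} [Ring R] (h : IsLeftGoldie R)
    {ι : Type*} [Nonempty ι] (Y : ι → Set R) :
    ∃ i, ∀ j, rightAnnihilator (Y j) ⊆ rightAnnihilator (Y i) →
      rightAnnihilator (Y i) ⊆ rightAnnihilator (Y j) := by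
  by_contra! hcon
  choose next hle hnle using hcon
  let i₀ : ι := Classical.arbitrary ι
  let a : ℕ → ι := fun n => next^[n] i₀
  have ha : ∀ n, a (n + 1) = next (a n) := fun n => Function.iterate_succ_apply' next n i₀
  -- The double annihilators of the chain form an ascending chain of left annihilators.
  obtain ⟨n, hn⟩ := h.acc_annihilators (fun n => rightAnnihilator (Y (a n)))
    (monotone_nat_of_le_succ fun n r hr x hx => hr x (by
      rw [ha] at hx
      exact hle _ hx))
  refine hnle (a n) fun x hx y hy => ?_
  have hy' : y ∈ leftAnnihilator (rightAnnihilator (Y (a (n + 1)))) := fun z hz =>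
    hz y (by rwa [ha])
  rw [hn (n + 1) n.le_succ] at hy'
  exact hy' x hx

/-- A nonzero ring with the descending chain condition on right annihilators has a nonzero right
ideal `U` such that each left multiplication is zero or injective on `U`: a minimal nonzero right
annihilator. It plays the role of a minimal right ideal of a matrix ring. -/
theorem IsLeftGoldie.exists_minimal_ideal {S : Type*} [Ring S] [Nontrivial S]
    (h : IsLeftGoldie S) :
    ∃ U : Set S, (∃ u ∈ U, u ≠ 0) ∧ (∀ u ∈ U, ∀ s, u * s ∈ U) ∧
      ∀ a, (∃ u ∈ U, a * u ≠ 0) → ∀ u ∈ U, a * u = 0 → u = 0 := by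
  let ι := {Y : Set S // ∃ u ∈ rightAnnihilator Y, u ≠ 0}
  have : Nonempty ι := ⟨∅, 1, fun x hx => absurd hx (Set.notMem_empty x), one_ne_zero⟩
  obtain ⟨Y, hY⟩ := h.exists_minimal_rightAnnihilator (fun Y : ι => Y.1)
  refine ⟨rightAnnihilator Y.1, Y.2, fun u hu s y hy => ?_, ?_⟩
  · rw [← mul_assoc, hu y hy, zero_mul]
  · rintro a ⟨u, hu, hau⟩ x hx hax
    by_contra hx0
    refine hau (hY ⟨insert a Y.1, x, ?_, hx0⟩
      (fun z hz y hy => hz y (Set.mem_insert_of_mem a hy)) hu a (Set.mem_insert a _))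
    rintro y (rfl | hy)
    exacts [hax, hx y hy]

namespace BilinearContext

variable {k R S M N : Type*} [Field k] [Ring R] [Algebra k R] [Ring S] [Algebra k S]
  [AddCommGroup M] [Module k M] [AddCommGroup N] [Module k N]
  {C : BilinearContext k R S M N}

/-- `M` embeds, as a left `R`-module, into a finite power of `R`. -/
theorem Nondegenerate.exists_finite_separating (hC : C.Nondegenerate)
    (hS : IsLeftGoldie Sᵐᵒᵖ) :
    ∃ (t : ℕ) (n : Fin t → N), ∀ m, (∀ i, C.mn m (n i) = 0) → m = 0 := by
  obtain ⟨⟨t, n⟩, hmin⟩ := hS.exists_minimal_rightAnnihilator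
    (fun i : Σ t, Fin t → N => {x | ∃ j m, x = MulOpposite.op (C.nm (i.2 j) m)})
  have key : ∀ s, (∀ i m, s * C.nm (n i) m = 0) → s = 0 := by
    intro s hs
    refine hC.eq_zero_of_sn s fun n₀ => hC.eq_zero_of_nm_left _ fun m => ?_
    have := hmin ⟨t + 1, Fin.cons n₀ n⟩ ?_ (a := MulOpposite.op s) ?_
      (MulOpposite.op (C.nm n₀ m)) ⟨0, m, rfl⟩
    · rw [C.s_n_m]
      exact MulOpposite.op_injective this
    · rintro z hz x ⟨j, m, rfl⟩
      exact hz _ ⟨j.succ, m, rfl⟩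
    · rintro x ⟨j, m, rfl⟩
      exact MulOpposite.unop_injective (hs j m)
  refine ⟨t, n, fun m hm => hC.eq_zero_of_nm_right m fun n' => key _ fun i m' => ?_⟩
  rw [C.n_m_s, ← C.m_n_m, hm, map_zero, LinearMap.zero_apply, map_zero]

/-- A weak form of a dual basis: for the right ideal `U` of `IsLeftGoldie.exists_minimal_ideal`,
there are injective right `S`-linear maps `M → U ^ t` (with entries `f i`) and `U ^ t → M`
(with entries `g i`) for one and the same `t`. (For Goldie rings `t` is the uniform dimension of `M`.) -/
theorem Nondegenerate.exists_dual_system (hC : C.Nondegenerate) (hR : IsLeftGoldie R)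
    (hS : IsPrimeRing S) {U : Set S} (hU₀ : ∃ u ∈ U, u ≠ 0) (hUS : ∀ u ∈ U, ∀ s, u * s ∈ U)
    (hU : ∀ a, (∃ u ∈ U, a * u ≠ 0) → ∀ u ∈ U, a * u = 0 → u = 0) :
    ∃ (t : ℕ) (f : Fin t → N) (g : Fin t → M), (∀ i m, C.nm (f i) m ∈ U) ∧
      (∀ m, (∀ i, C.nm (f i) m = 0) → m = 0) ∧
      ∀ y : Fin t → S, (∀ i, y i ∈ U) → ∑ i, C.ms (g i) (y i) = 0 → ∀ i, y i = 0 := by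
  -- Among all systems for which the composite `U ^ t → M → U ^ t` is injective, take one for which
  -- the kernel `K` of `M → U ^ t` is minimal. If `K ≠ 0` then the system can be enlarged.
  let ι := {x : Σ t, (Fin t → N) × (Fin t → M) // (∀ i m, C.nm (x.2.1 i) m ∈ U) ∧
    ∀ y : Fin x.1 → S, (∀ i, y i ∈ U) →
      (∀ i, C.nm (x.2.1 i) (∑ j, C.ms (x.2.2 j) (y j)) = 0) → ∀ i, y i = 0}
  have : Nonempty ι := ⟨⟨0, Fin.elim0, Fin.elim0⟩, fun i => i.elim0, fun _ _ _ i => i.elim0⟩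
  obtain ⟨⟨⟨t, f, g⟩, hfU, hfg⟩, hmin⟩ := hR.exists_minimal_rightAnnihilator
    (fun x : ι => {r | ∃ i m, r = C.mn m (x.1.2.1 i)})
  dsimp only at hfU hfg hmin
  refine ⟨t, f, g, hfU, fun x hx => ?_, fun y hyU hy => hfg y hyU fun i => by rw [hy, map_zero]⟩
  by_contra hx0
  obtain ⟨u, hu, hu0⟩ := hU₀
  obtain ⟨n, hn⟩ : ∃ n, C.nm n x ≠ 0 := by
    by_contra! h
    exact hx0 (hC.eq_zero_of_nm_right x h)
  obtain ⟨a, ha⟩ : ∃ a, u * a * C.nm n x ≠ 0 := by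
    by_contra! h
    exact (hS.eq_zero_or_eq_zero _ _ h).elim hu0 hn
  -- the new entry of `f` maps `M` into `U` and does not kill `x ∈ K`
  let f₀ := C.sn (u * a) n
  have hf₀x : C.nm f₀ x ≠ 0 := by rwa [C.s_n_m]
  obtain ⟨b, hb⟩ : ∃ b, C.nm f₀ x * b * u ≠ 0 := by
    by_contra! h
    exact (hS.eq_zero_or_eq_zero _ _ h).elim hf₀x hu0
  -- the new entry of `g` maps `U` into `K` and its composite with `f₀` is nonzero on `U`
  let g₀ := C.ms x b
  have hg₀ : ∀ i s, C.nm (f i) (C.ms g₀ s) = 0 := fun i s => by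
    rw [← C.n_m_s, ← C.n_m_s, hx i, zero_mul, zero_mul]
  have hf₀U : ∀ m, C.nm f₀ m ∈ U := fun m => by
    rw [C.s_n_m, mul_assoc]
    exact hUS u hu _
  have hnew : ∀ y : Fin (t + 1) → S, (∀ i, y i ∈ U) →
      (∀ i, C.nm ((Fin.cons f₀ f : Fin (t + 1) → N) i)
        (∑ j, C.ms ((Fin.cons g₀ g : Fin (t + 1) → M) j) (y j)) = 0) → ∀ i, y i = 0 := by
    intro y hyU hy
    simp only [Fin.forall_fin_succ, Fin.sum_univ_succ, Fin.cons_zero, Fin.cons_succ,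
      map_add] at hy
    have hsucc : ∀ i : Fin t, y i.succ = 0 :=
      hfg (fun i => y i.succ) (fun i => hyU _) fun i => by simpa [hg₀] using hy.2 i
    refine Fin.forall_fin_succ.2 ⟨?_, hsucc⟩
    refine hU (C.nm f₀ g₀) ⟨u, hu, ?_⟩ _ (hyU 0) ?_
    · rwa [← C.n_m_s]
    · simpa [hsucc, C.n_m_s] using hy.1
  have hmem := hmin ⟨⟨t + 1, Fin.cons f₀ f, Fin.cons g₀ g⟩, Fin.forall_fin_succ.2 ⟨hf₀U, hfU⟩, hnew⟩
    (by
      rintro z hz r ⟨i, m, rfl⟩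
      exact hz _ ⟨i.succ, m, rfl⟩)
  refine hf₀x (hC.eq_zero_of_sn _ fun n' => hC.eq_zero_of_mn_right _ fun m' => ?_)
  rw [C.n_m_n, ← C.m_n_r]
  refine hmem ?_ _ ⟨0, m', rfl⟩
  rintro r ⟨i, m, rfl⟩
  rw [C.m_n_r, ← C.n_m_n, hx i, map_zero, LinearMap.zero_apply, map_zero]

end BilinearContext

/-! ### Volume difference inequalities -/

section VolumeDifference

variable {k : Type*} [Field k]

/-- The common form `dim V W ≥ dim W + c (dim W) ^ e` of the inequalities `VDI` and `VDITop`. -/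
def VolumeDifference {A : Type*} [Ring A] [Algebra k A] (V : Submodule k A) (c e : ℝ) : Prop :=
  ∀ W : Submodule k A, W ≠ ⊥ → FiniteDimensional k W →
    (Module.finrank k W : ℝ) + c * (Module.finrank k W : ℝ) ^ e ≤
      (Module.finrank k (V * W : Submodule k A) : ℝ)

theorem vdi_iff {A : Type*} [Ring A] [Algebra k A] {V : Submodule k A} {d : ℝ} :
    VDI k V d ↔ ∃ c, 0 < c ∧ VolumeDifference V c ((d - 1) / d) := Iff.rfl

theorem vdiTop_iff {A : Type*} [Ring A] [Algebra k A] {V : Submodule k A} :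
    VDITop k V ↔ ∃ c, 0 < c ∧ VolumeDifference V c 1 := by
  simp only [VDITop, VolumeDifference, Real.rpow_one]

/-- The case distinction in the definition of `lowerTrdeg` is redundant: if every subframe `V` has
a `W ≠ 0` with `dim V W = dim W`, then no volume difference inequality holds and the supremum is
zero. -/
theorem lowerTrdeg_eq_iSup (A : Type*) [Ring A] [Algebra k A] :
    lowerTrdeg k A = ⨆ (V : Submodule k A) (_ : IsSubframe k V),
      sSup {d : ℝ≥0∞ | (∃ x : ℝ, 0 < x ∧ d = ENNReal.ofReal x ∧ VDI k V x) ∨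
        (d = ⊤ ∧ VDITop k V)} := by
  unfold lowerTrdeg
  split_ifs with h
  · symm
    refine iSup₂_eq_bot.2 fun V hV => ?_
    obtain ⟨W, hW, hWfin, heq⟩ := h V hV
    have hpos : (0 : ℝ) < Module.finrank k W :=
      Nat.cast_pos.2 (Nat.pos_of_ne_zero fun h0 => hW (Submodule.finrank_eq_zero.1 h0))
    have hno : ∀ c e : ℝ, 0 < c → ¬ VolumeDifference V c e := fun c e hc hV => by
      have h1 := hV W hW hWfin
      rw [heq] at h1
      have h2 := mul_pos hc (Real.rpow_pos_of_pos hpos e)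
      linarith
    refine sSup_eq_bot.2 ?_
    rintro d (⟨x, -, -, hx⟩ | ⟨-, hx⟩)
    · obtain ⟨c, hc, hVc⟩ := vdi_iff.1 hx
      exact absurd hVc (hno c _ hc)
    · obtain ⟨c, hc, hVc⟩ := vdiTop_iff.1 hx
      exact absurd hVc (hno c _ hc)
  · rfl

theorem lowerTrdeg_le_of_volumeDifference {A B : Type*} [Ring A] [Algebra k A] [Ring B]
    [Algebra k B]
    (h : ∀ (V : Submodule k A) (c e : ℝ), IsSubframe k V → 0 < c → VolumeDifference V c e →
      ∃ (V' : Submodule k B) (c' : ℝ), IsSubframe k V' ∧ 0 < c' ∧ VolumeDifference V' c' e) :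
    lowerTrdeg k A ≤ lowerTrdeg k B := by
  rw [lowerTrdeg_eq_iSup, lowerTrdeg_eq_iSup]
  refine iSup₂_le fun V hV => sSup_le ?_
  rintro d (⟨x, hx, rfl, hVx⟩ | ⟨rfl, hVx⟩)
  · obtain ⟨c, hc, hVc⟩ := vdi_iff.1 hVx
    obtain ⟨V', c', hV', hc', h'⟩ := h V c _ hV hc hVc
    exact le_iSup₂_of_le V' hV' (le_sSup (Or.inl ⟨x, hx, rfl, vdi_iff.2 ⟨c', hc', h'⟩⟩))
  · obtain ⟨c, hc, hVc⟩ := vdiTop_iff.1 hVx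
    obtain ⟨V', c', hV', hc', h'⟩ := h V c _ hV hc hVc
    exact le_iSup₂_of_le V' hV' (le_sSup (Or.inr ⟨rfl, vdiTop_iff.2 ⟨c', hc', h'⟩⟩))

theorem finiteDimensional_map₂ {X Y Z : Type*} [AddCommGroup X] [Module k X] [AddCommGroup Y]
    [Module k Y] [AddCommGroup Z] [Module k Z] (f : X →ₗ[k] Y →ₗ[k] Z) (p : Submodule k X)
    (q : Submodule k Y) [FiniteDimensional k p] [FiniteDimensional k q] :
    FiniteDimensional k (Submodule.map₂ f p q) :=
  Module.Finite.iff_fg.2 ((Module.Finite.iff_fg.1 ‹_›).map₂ f (Module.Finite.iff_fg.1 ‹_›))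

instance finiteDimensional_mul {A : Type*} [Ring A] [Algebra k A] (V W : Submodule k A)
    [FiniteDimensional k V] [FiniteDimensional k W] :
    FiniteDimensional k (V * W : Submodule k A) :=
  Module.Finite.iff_fg.2 ((Module.Finite.iff_fg.1 ‹_›).mul (Module.Finite.iff_fg.1 ‹_›))

theorem finrank_map_add_finrank_inf_ker {X Y : Type*} [AddCommGroup X] [Module k X]
    [AddCommGroup Y] [Module k Y] (f : X →ₗ[k] Y) (Z : Submodule k X) [FiniteDimensional k Z] :
    Module.finrank k (Z.map f) + Module.finrank k (Z ⊓ LinearMap.ker f : Submodule k X) =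
      Module.finrank k Z := by
  have h := LinearMap.finrank_range_add_finrank_ker (f.domRestrict Z)
  rw [LinearMap.range_domRestrict, LinearMap.ker_domRestrict] at h
  rw [← h, (Submodule.equivSubtypeMap Z ((LinearMap.ker f).comap Z.subtype)).finrank_eq,
    Submodule.map_comap_subtype]

/-- The filtration of a space `Z` by the kernels of `R`-linear maps `φ 0`, `φ 1`, … to `R` has
graded pieces `W i` in `R`, and `V Z` is at least as large as the sum of the `V (W i)`. -/
theorem exists_graded_pieces {R X : Type*} [Ring R] [Algebra k R] [AddCommGroup X] [Module k X]
    (α : R →ₗ[k] X →ₗ[k] X) (V : Submodule k R) [FiniteDimensional k V] {t : ℕ}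
    (φ : Fin t → X →ₗ[k] R) (hφ : ∀ i r x, φ i (α r x) = r * φ i x) (Z : Submodule k X)
    [FiniteDimensional k Z] (hZ : ∀ z ∈ Z, (∀ i, φ i z = 0) → z = 0) :
    ∃ W : Fin t → Submodule k R, (∀ i, FiniteDimensional k (W i)) ∧
      ∑ i, Module.finrank k (W i) = Module.finrank k Z ∧
      ∑ i, Module.finrank k (V * W i : Submodule k R) ≤
        Module.finrank k (Submodule.map₂ α V Z) := by
  induction t generalizing Z with
  | zero =>
    refine ⟨Fin.elim0, fun i => i.elim0, ?_, by simp⟩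
    have : Z = ⊥ := (Submodule.eq_bot_iff Z).2 fun z hz => hZ z hz fun i => i.elim0
    rw [Fin.sum_univ_zero, this, finrank_bot]
  | succ t ih =>
    let Z' : Submodule k X := Z ⊓ LinearMap.ker (φ 0)
    have : FiniteDimensional k Z' := Submodule.finiteDimensional_of_le inf_le_left
    obtain ⟨W, hW, hsum, hle⟩ := ih (fun i => φ i.succ) (fun i => hφ _) Z' fun z hz h =>
      hZ z hz.1 (Fin.forall_fin_succ.2 ⟨hz.2, h⟩)
    refine ⟨Fin.cons (Z.map (φ 0)) W, Fin.forall_fin_succ.2 ⟨?_, hW⟩, ?_, ?_⟩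
    · exact inferInstanceAs (FiniteDimensional k (Z.map (φ 0)))
    · rw [Fin.sum_univ_succ]
      change Module.finrank k (Z.map (φ 0)) + ∑ i, Module.finrank k (W i) = _
      rw [hsum, finrank_map_add_finrank_inf_ker]
    · rw [Fin.sum_univ_succ]
      change Module.finrank k (V * Z.map (φ 0) : Submodule k R) +
        ∑ i, Module.finrank k (V * W i : Submodule k R) ≤ _
      have := finiteDimensional_map₂ α V Z
      rw [← finrank_map_add_finrank_inf_ker (φ 0) (Submodule.map₂ α V Z)]
      refine add_le_add (Submodule.finrank_mono (Submodule.mul_le.2 ?_)) (hle.trans ?_)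
      · rintro v hv _ ⟨z, hz, rfl⟩
        exact ⟨α v z, Submodule.apply_mem_map₂ _ hv hz, hφ 0 v z⟩
      · have : FiniteDimensional k
            (Submodule.map₂ α V Z ⊓ LinearMap.ker (φ 0) : Submodule k X) :=
          Submodule.finiteDimensional_of_le inf_le_left
        refine Submodule.finrank_mono (Submodule.map₂_le.2 fun v hv z hz =>
          ⟨Submodule.apply_mem_map₂ _ hv hz.1, ?_⟩)
        rw [SetLike.mem_coe, LinearMap.mem_ker, hφ, LinearMap.mem_ker.1 hz.2, mul_zero]

/-- A volume difference inequality for `R` passes, with a smaller constant and the same exponent,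
to every left `R`-module that embeds into `R ^ t`. -/
theorem VolumeDifference.exists_of_embedding {R X : Type*} [Ring R] [Algebra k R]
    [AddCommGroup X] [Module k X]
    (α : R →ₗ[k] X →ₗ[k] X) {V : Submodule k R} (hVf : IsSubframe k V) {c e : ℝ} (hc : 0 < c)
    (hV : VolumeDifference V c e) {t : ℕ}
    (φ : Fin t → X →ₗ[k] R) (hφ : ∀ i r x, φ i (α r x) = r * φ i x)
    (hinj : ∀ z, (∀ i, φ i z = 0) → z = 0) :
    ∃ c', 0 < c' ∧ ∀ Z : Submodule k X, Z ≠ ⊥ → FiniteDimensional k Z →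
      (Module.finrank k Z : ℝ) + c' * (Module.finrank k Z : ℝ) ^ e ≤
        (Module.finrank k (Submodule.map₂ α V Z) : ℝ) := by
  have := hVf.finite
  rcases Nat.eq_zero_or_pos t with rfl | ht
  · exact ⟨1, one_pos, fun Z hZ _ => absurd ((Submodule.eq_bot_iff Z).2 fun z _ =>
      hinj z fun i => i.elim0) hZ⟩
  have ht' : (1 : ℝ) ≤ t := by exact_mod_cast ht
  refine ⟨c * (t : ℝ) ^ (-|e|), by positivity, fun Z hZ hZf => ?_⟩
  obtain ⟨W, hWf, hsum, hle⟩ := exists_graded_pieces α V φ hφ Z fun z _ => hinj z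
  have : Nonempty (Fin t) := ⟨⟨0, ht⟩⟩
  obtain ⟨i, hi⟩ := Finite.exists_max fun i => Module.finrank k (W i)
  have hle1 : ∀ j, W j ≤ V * W j := fun j w hw => by
    simpa using Submodule.mul_mem_mul hVf.one_mem hw
  have hmono : ∀ j, Module.finrank k (W j) ≤ Module.finrank k (V * W j : Submodule k R) :=
    fun j => Submodule.finrank_mono (hle1 j)
  have hZpos : 0 < Module.finrank k Z :=
    Nat.pos_of_ne_zero fun h0 => hZ (Submodule.finrank_eq_zero.1 h0)
  -- the largest piece has dimension at least `dim Z / t`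
  have hbig : Module.finrank k Z ≤ t * Module.finrank k (W i) := by
    rw [← hsum]
    simpa using Finset.sum_le_card_nsmul Finset.univ _ _ fun j _ => hi j
  have hsmall : Module.finrank k (W i) ≤ Module.finrank k Z := by
    rw [← hsum]
    exact Finset.single_le_sum (f := fun j => Module.finrank k (W j)) (fun _ _ => Nat.zero_le _)
      (Finset.mem_univ i)
  have hWpos : 0 < Module.finrank k (W i) := Nat.pos_of_mul_pos_left (hZpos.trans_le hbig)
  have hWi : W i ≠ ⊥ := fun h => by
    rw [h, finrank_bot] at hWpos
    exact hWpos.false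
  have hdiff := hV (W i) hWi (hWf i)
  have hpow : (t : ℝ) ^ (-|e|) * (Module.finrank k Z : ℝ) ^ e ≤
      (Module.finrank k (W i) : ℝ) ^ e := by
    have hbig' : (Module.finrank k Z : ℝ) ≤ t * Module.finrank k (W i) := by exact_mod_cast hbig
    have hsmall' : (Module.finrank k (W i) : ℝ) ≤ Module.finrank k Z := by exact_mod_cast hsmall
    have hW0 : (0 : ℝ) < Module.finrank k (W i) := by exact_mod_cast hWpos
    have hZ0 : (0 : ℝ) < Module.finrank k Z := by exact_mod_cast hZpos
    rcases le_total 0 e with he | he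
    · rw [abs_of_nonneg he]
      calc (t : ℝ) ^ (-e) * (Module.finrank k Z : ℝ) ^ e
          ≤ (t : ℝ) ^ (-e) * (t * Module.finrank k (W i)) ^ e := by gcongr
        _ = (Module.finrank k (W i) : ℝ) ^ e := by
          rw [Real.mul_rpow (by positivity) hW0.le, ← mul_assoc, ← Real.rpow_add (by positivity)]
          simp
    · calc (t : ℝ) ^ (-|e|) * (Module.finrank k Z : ℝ) ^ e
          ≤ 1 * (Module.finrank k Z : ℝ) ^ e := by
            gcongr
            exact Real.rpow_le_one_of_one_le_of_nonpos ht' (neg_nonpos.2 (abs_nonneg e))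
        _ ≤ _ := by
          rw [one_mul]
          exact Real.rpow_le_rpow_of_nonpos hW0 hsmall' he
  have hrest : ∑ j ∈ Finset.univ.erase i, (Module.finrank k (W j) : ℝ) ≤
      ∑ j ∈ Finset.univ.erase i, (Module.finrank k (V * W j : Submodule k R) : ℝ) :=
    Finset.sum_le_sum fun j _ => by exact_mod_cast hmono j
  have hsum' : (∑ j, (Module.finrank k (W j) : ℝ)) = Module.finrank k Z := by exact_mod_cast hsum
  have hle' : (∑ j, (Module.finrank k (V * W j : Submodule k R) : ℝ)) ≤
      Module.finrank k (Submodule.map₂ α V Z) := by exact_mod_cast hle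
  rw [← Finset.add_sum_erase _ _ (Finset.mem_univ i)] at hsum' hle'
  have := mul_le_mul_of_nonneg_left hpow hc.le
  linarith

/-- The subspace `W ^ ι` of `A ^ ι`. -/
def piRange (ι : Type*) {A : Type*} [AddCommGroup A] [Module k A] (W : Submodule k A) :
    Submodule k (ι → A) :=
  LinearMap.range (W.subtype.compLeft ι)

theorem mem_piRange {ι A : Type*} [AddCommGroup A] [Module k A] {W : Submodule k A}
    {x : ι → A} : x ∈ piRange ι W ↔ ∀ i, x i ∈ W := by
  constructor
  · rintro ⟨y, rfl⟩ i
    exact (y i).2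
  · exact fun h => ⟨fun i => ⟨x i, h i⟩, rfl⟩

theorem injective_compLeft_subtype (ι : Type*) {A : Type*} [AddCommGroup A] [Module k A]
    (W : Submodule k A) : Function.Injective (W.subtype.compLeft ι) := fun _ _ h =>
  funext fun i => Subtype.ext (congrFun h i)

theorem finrank_piRange (ι : Type*) [Fintype ι] {A : Type*} [AddCommGroup A] [Module k A]
    (W : Submodule k A) [FiniteDimensional k W] :
    Module.finrank k (piRange ι W) = Fintype.card ι * Module.finrank k W := by
  rw [piRange, LinearMap.finrank_range_of_inj (injective_compLeft_subtype ι W),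
    Module.finrank_pi_fintype, Finset.sum_const, Finset.card_univ, smul_eq_mul]

instance finiteDimensional_piRange (ι : Type*) [Finite ι] {A : Type*} [AddCommGroup A]
    [Module k A] (W : Submodule k A) [FiniteDimensional k W] :
    FiniteDimensional k (piRange ι W) :=
  inferInstanceAs (FiniteDimensional k (LinearMap.range (W.subtype.compLeft ι)))

end VolumeDifference

namespace BilinearContext

variable {k R S M N : Type*} [Field k] [Ring R] [Algebra k R] [Ring S] [Algebra k S]
  [AddCommGroup M] [Module k M] [AddCommGroup N] [Module k N]
  {C : BilinearContext k R S M N}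

/-- There are injective right `S`-linear maps `S ^ q → M ^ p → S ^ q`, given by matrices over `M` and
over `N`. With `p` and `q` the lengths of the dual systems of `S` and of `M`, both modules embed into
`U ^ (p * q)` and conversely. -/
theorem Nondegenerate.exists_matrices (hC : C.Nondegenerate) (hR : IsLeftGoldie R)
    (hS : IsPrimeRing S) (hS' : IsLeftGoldie S) :
    ∃ (p q : ℕ) (a : Fin p → Fin q → M) (b : Fin q → Fin p → N), 0 < q ∧
      (∀ s : Fin q → S, (∀ i, ∑ j, C.ms (a i j) (s j) = 0) → s = 0) ∧
      ∀ m : Fin p → M, (∀ j, ∑ i, C.nm (b j i) (m i) = 0) → m = 0 := by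
  have := hS.nontrivial
  obtain ⟨U, hU₀, hUS, hU⟩ := hS'.exists_minimal_ideal
  obtain ⟨p, f, g, hfU, hf, hg⟩ :=
    (nondegenerate_self (k := k) (S := S)).exists_dual_system hS' hS hU₀ hUS hU
  obtain ⟨q, F, G, hFU, hF, hG⟩ := hC.exists_dual_system hR hS hU₀ hUS hU
  simp only [self, LinearMap.mul_apply'] at hfU hf hg
  refine ⟨p, q, fun i j => C.ms (G j) (f i), fun j i => C.sn (g i) (F j), ?_, fun s hs => ?_,
    fun m hm => ?_⟩
  · rcases Nat.eq_zero_or_pos q with rfl | hq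
    · -- if `q = 0` then `M = 0`, and a nondegenerate context with `M = 0` has `S = 0`
      refine absurd (hC.eq_zero_of_sn 1 fun n => hC.eq_zero_of_nm_left _ fun m => ?_) one_ne_zero
      rw [hF m fun i => i.elim0, map_zero]
    · exact hq
  · funext j
    refine hf _ fun i => hG (fun j => f i * s j) (fun j => hfU i _) ?_ j
    simpa only [C.m_s_s] using hs i
  · funext i
    refine hF _ fun j => hg (fun i => C.nm (F j) (m i)) (fun i => hFU j _) ?_ i
    simpa only [C.s_n_m] using hm j

/-- Transfer of a volume difference inequality from `R` to `S`. If `W ⊆ S` and `Z ⊆ M ^ p` is the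
image of `W ^ q`, then `V Z` embeds into `(V' W) ^ q`, where `V'` is spanned by the products
`n v m` of `v ∈ V` with the entries of the two matrices. As both maps are injective, no dimension is
lost in the leading term. -/
theorem Nondegenerate.exists_volumeDifference (hC : C.Nondegenerate) (hR : IsLeftGoldie R)
    (hS : IsPrimeRing S) (hS' : IsGoldie S) {V : Submodule k R} (hVf : IsSubframe k V)
    {c e : ℝ} (hc : 0 < c) (hV : VolumeDifference V c e) :
    ∃ (V' : Submodule k S) (c' : ℝ), IsSubframe k V' ∧ 0 < c' ∧ VolumeDifference V' c' e := by
  have := hVf.finite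
  obtain ⟨p, q, a, b, hq, ha, hb⟩ := hC.exists_matrices hR hS hS'.left
  obtain ⟨t, n, hn⟩ := hC.exists_finite_separating hS'.right
  let α : R →ₗ[k] (Fin p → M) →ₗ[k] (Fin p → M) :=
    LinearMap.mk₂ k (fun r m i => C.rm r (m i))
      (fun _ _ _ => by ext; simp) (fun _ _ _ => by ext; simp)
      (fun _ _ _ => by ext; simp) (fun _ _ _ => by ext; simp)
  let φ : Fin (p * t) → (Fin p → M) →ₗ[k] R := fun x =>
    C.mn.flip (n (finProdFinEquiv.symm x).2) ∘ₗ LinearMap.proj (finProdFinEquiv.symm x).1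
  obtain ⟨c₁, hc₁, hZ⟩ := hV.exists_of_embedding α hVf hc φ
    (fun x r m => by simp [φ, α, C.r_m_n])
    (fun m hm => funext fun i => hn _ fun j => by
      simpa only [φ, Equiv.symm_apply_apply, LinearMap.comp_apply, LinearMap.flip_apply,
        LinearMap.proj_apply] using hm (finProdFinEquiv (i, j)))
  let A : (Fin q → S) →ₗ[k] (Fin p → M) :=
    LinearMap.pi fun i => ∑ j, C.ms (a i j) ∘ₗ LinearMap.proj j
  let B : (Fin p → M) →ₗ[k] (Fin q → S) :=
    LinearMap.pi fun j => ∑ i, C.nm (b j i) ∘ₗ LinearMap.proj i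
  have hA : Function.Injective A := (injective_iff_map_eq_zero A).2 fun s hs =>
    ha s fun i => by simpa [A] using congrFun hs i
  have hB : Function.Injective B := (injective_iff_map_eq_zero B).2 fun m hm =>
    hb m fun j => by simpa [B] using congrFun hm j
  let β : (Fin q × Fin p) × (Fin p × Fin q) → R →ₗ[k] S := fun x =>
    C.nm (b x.1.1 x.1.2) ∘ₗ C.rm.flip (a x.2.1 x.2.2)
  let V' : Submodule k S := 1 ⊔ ⨆ x, V.map (β x)
  have hV'f : IsSubframe k V' := by
    constructor
    · have : FiniteDimensional k (1 : Submodule k S) := by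
        rw [Submodule.one_eq_span]
        infer_instance
      exact Submodule.finiteDimensional_sup _ _
    · exact Submodule.mem_sup_left (Submodule.one_le.1 le_rfl)
  have := hV'f.finite
  have hq0 : (0 : ℝ) < q := by exact_mod_cast hq
  refine ⟨V', c₁ * (q : ℝ) ^ e / q, hV'f, by positivity, fun W hW hWf => ?_⟩
  let Z : Submodule k (Fin p → M) := (piRange (Fin q) W).map A
  have hZrank : Module.finrank k Z = q * Module.finrank k W := by
    rw [(Submodule.equivMapOfInjective A hA _).symm.finrank_eq, finrank_piRange, Fintype.card_fin]
  have hWpos : 0 < Module.finrank k W :=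
    Nat.pos_of_ne_zero fun h0 => hW (Submodule.finrank_eq_zero.1 h0)
  have hZ0 : Z ≠ ⊥ := fun h => by
    rw [h, finrank_bot] at hZrank
    exact (Nat.mul_pos hq hWpos).ne hZrank
  have hVZ : (Submodule.map₂ α V Z).map B ≤ piRange (Fin q) (V' * W) := by
    rw [Submodule.map_le_iff_le_comap, Submodule.map₂_le]
    rintro v hv _ ⟨w, hw, rfl⟩
    rw [Submodule.mem_comap, mem_piRange]
    intro j
    have hBj : B (α v (A w)) j =
        ∑ i, ∑ l, C.nm (b j i) (C.rm v (a i l)) * w l := by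
      simp [A, B, α, C.n_m_s, C.r_m_s]
    rw [hBj]
    refine Submodule.sum_mem _ fun i _ => Submodule.sum_mem _ fun l _ =>
      Submodule.mul_mem_mul (Submodule.mem_sup_right ?_) (mem_piRange.1 hw l)
    exact Submodule.mem_iSup_of_mem ((j, i), (i, l)) ⟨v, hv, rfl⟩
  have hle := Submodule.finrank_mono hVZ
  rw [(Submodule.equivMapOfInjective B hB _).symm.finrank_eq, finrank_piRange, Fintype.card_fin] at hle
  have hmain := (hZ Z hZ0 inferInstance).trans (Nat.cast_le.2 hle)
  rw [hZrank] at hmain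
  push_cast at hmain
  rw [Real.mul_rpow hq0.le (Nat.cast_nonneg _)] at hmain
  refine le_of_mul_le_mul_left (le_of_eq_of_le ?_ hmain) hq0
  field_simp

theorem Nondegenerate.lowerTrdeg_eq (hC : C.Nondegenerate) (hR : IsPrimeRing R)
    (hR' : IsGoldie R) (hS : IsPrimeRing S) (hS' : IsGoldie S) :
    lowerTrdeg k R = lowerTrdeg k S :=
  le_antisymm
    (lowerTrdeg_le_of_volumeDifference fun _ _ _ hVf hc hV =>
      hC.exists_volumeDifference hR'.left hS hS' hVf hc hV)
    (lowerTrdeg_le_of_volumeDifference fun _ _ _ hVf hc hV =>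
      hC.swap.exists_volumeDifference hS'.left hR hR' hVf hc hV)

end BilinearContext

/-! ### Gelfand–Kirillov dimension -/

namespace BilinearContext

variable {k R S M N : Type*} [Field k] [Ring R] [Algebra k R] [Ring S] [Algebra k S]
  [AddCommGroup M] [Module k M] [AddCommGroup N] [Module k N]
  {C : BilinearContext k R S M N}

/-- If `1 = ∑ mᵢ nᵢ` in `R` and the subspace `V'` of `S` contains all `nᵢ V mⱼ`, then
`nᵢ V ^ l mⱼ ⊆ V' ^ l` for `l ≥ 1`; since `x = ∑ mᵢ (nᵢ x mⱼ) nⱼ`, the space `V ^ l` embeds into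
`(V' ^ l) ^ (t * t)`. -/
theorem finrank_pow_le {t : ℕ} (m : Fin t → M) (n : Fin t → N)
    (hmn : ∑ i, C.mn (m i) (n i) = 1) {V : Submodule k R} {V' : Submodule k S}
    (hV : ∀ i j, ∀ v ∈ V, C.nm (n i) (C.rm v (m j)) ∈ V') [FiniteDimensional k V'] {l : ℕ}
    (hl : 1 ≤ l) :
    Module.finrank k (V ^ l : Submodule k R) ≤
      t * t * Module.finrank k (V' ^ l : Submodule k S) := by
  have hpow : ∀ x ∈ V ^ l, ∀ i j, C.nm (n i) (C.rm x (m j)) ∈ V' ^ l := by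
    induction l, hl using Nat.le_induction with
    | base => simpa only [pow_one] using fun x hx i j => hV i j x hx
    | succ l hl ih =>
      intro x hx i j
      rw [pow_succ] at hx ⊢
      induction hx using Submodule.mul_induction_on' with
      | mem_mul_mem y hy z hz =>
        have : C.nm (n i) (C.rm (y * z) (m j)) =
            ∑ a, C.nm (n i) (C.rm y (m a)) * C.nm (n a) (C.rm z (m j)) := by
          simp only [C.n_m_s, C.r_m_s, ← C.m_n_m]
          rw [C.r_r_m, ← map_sum, ← map_sum, ← LinearMap.sum_apply, ← map_sum, hmn, C.one_m]
        rw [this]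
        exact Submodule.sum_mem _ fun a _ => Submodule.mul_mem_mul (ih y hy i a) (hV a j z hz)
      | add y _ z _ hy hz =>
        simpa only [map_add, LinearMap.add_apply] using Submodule.add_mem _ hy hz
  have hfin : FiniteDimensional k (V' ^ l : Submodule k S) :=
    Module.Finite.iff_fg.2 ((Module.Finite.iff_fg.1 ‹FiniteDimensional k V'›).pow l)
  let T : R →ₗ[k] (Fin t × Fin t → S) :=
    LinearMap.pi fun x => C.nm (n x.1) ∘ₗ C.rm.flip (m x.2)
  have hT : Function.Injective T := (injective_iff_map_eq_zero T).2 fun x hx => by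
    have hx' : ∀ i j, C.nm (n i) (C.rm x (m j)) = 0 := fun i j => congrFun hx (i, j)
    have hxm : ∀ j, C.rm x (m j) = 0 := fun j => by
      rw [← C.one_m (C.rm x (m j)), ← hmn, map_sum, LinearMap.sum_apply]
      exact Finset.sum_eq_zero fun i _ => by rw [C.m_n_m, hx', map_zero]
    rw [← mul_one x, ← hmn, Finset.mul_sum]
    exact Finset.sum_eq_zero fun j _ => by
      rw [← C.r_m_n, hxm, map_zero, LinearMap.zero_apply]
  rw [(Submodule.equivMapOfInjective T hT _).finrank_eq, show t * t = Fintype.card (Fin t × Fin t) by simp,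
    ← finrank_piRange]
  refine Submodule.finrank_mono ?_
  rintro _ ⟨x, hx, rfl⟩
  exact mem_piRange.2 fun i => hpow x hx i.1 i.2

theorem gkDim_le [Nontrivial R] {t : ℕ} (m : Fin t → M) (n : Fin t → N)
    (hmn : ∑ i, C.mn (m i) (n i) = 1) : gkDim k R ≤ gkDim k S := by
  refine iSup₂_le fun V hVf => ?_
  have := hVf.finite
  let V' : Submodule k S := 1 ⊔ ⨆ x : Fin t × Fin t, V.map (C.nm (n x.1) ∘ₗ C.rm.flip (m x.2))
  have hV'f : IsSubframe k V' := by
    constructor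
    · have : FiniteDimensional k (1 : Submodule k S) := by
        rw [Submodule.one_eq_span]
        infer_instance
      exact Submodule.finiteDimensional_sup _ _
    · exact Submodule.mem_sup_left (Submodule.one_le.1 le_rfl)
  have := hV'f.finite
  refine le_iSup₂_of_le V' hV'f ?_
  have hbound : ∀ l : ℕ, 1 ≤ l →
      ENNReal.ofReal (Real.log (Module.finrank k (V ^ l : Submodule k R)) / Real.log l) ≤
        ENNReal.ofReal (Real.log (t * t) / Real.log l) +
          ENNReal.ofReal (Real.log (Module.finrank k (V' ^ l : Submodule k S)) / Real.log l) := by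
    intro l hl
    have hle := finrank_pow_le m n hmn (V := V) (V' := V') (fun i j v hv =>
      Submodule.mem_sup_right (Submodule.mem_iSup_of_mem (i, j) ⟨v, hv, rfl⟩)) hl
    have hfin : FiniteDimensional k (V ^ l : Submodule k R) :=
      Module.Finite.iff_fg.2 ((Module.Finite.iff_fg.1 hVf.finite).pow l)
    have hpos : 0 < Module.finrank k (V ^ l : Submodule k R) := by
      refine Nat.pos_of_ne_zero fun h0 => one_ne_zero (α := R) ?_
      have h1 : (1 : R) ∈ V ^ l := by simpa using Submodule.pow_mem_pow V hVf.one_mem l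
      rwa [Submodule.finrank_eq_zero.1 h0] at h1
    have hpos' := hpos.trans_le hle
    have ht : (0 : ℝ) < t * t := by exact_mod_cast Nat.pos_of_mul_pos_right hpos'
    have hS : (0 : ℝ) < Module.finrank k (V' ^ l : Submodule k S) := by
      exact_mod_cast Nat.pos_of_mul_pos_left hpos'
    refine (ENNReal.ofReal_le_ofReal ?_).trans ENNReal.ofReal_add_le
    rw [← add_div, ← Real.log_mul ht.ne' hS.ne']
    refine div_le_div_of_nonneg_right (Real.log_le_log (by exact_mod_cast hpos) ?_)
      (Real.log_natCast_nonneg l)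
    exact_mod_cast hle
  have hlim : Filter.Tendsto (fun l : ℕ => ENNReal.ofReal (Real.log (t * t) / Real.log l))
      Filter.atTop (nhds 0) := by
    rw [← ENNReal.ofReal_zero]
    exact ENNReal.tendsto_ofReal
      ((Real.tendsto_log_atTop.comp tendsto_natCast_atTop_atTop).const_div_atTop _)
  calc _ ≤ Filter.limsup (fun l : ℕ => ENNReal.ofReal (Real.log (t * t) / Real.log l) +
          ENNReal.ofReal (Real.log (Module.finrank k (V' ^ l : Submodule k S)) / Real.log l))
          Filter.atTop :=
        Filter.limsup_le_limsup (Filter.eventually_atTop.2 ⟨1, hbound⟩)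
    _ = _ := ENNReal.limsup_add_of_left_tendsto_zero hlim _

end BilinearContext

/-! ### Contexts from Morita equivalences -/

section MoritaEquivalence

open CategoryTheory

/-- Two objects `X` and `Y` of a `k`-linear category give a context between their endomorphism
rings, with `M = Hom(X, Y)`, `N = Hom(Y, X)` and all products given by composition (in diagrammatic
order). -/
def BilinearContext.ofHom {k R S : Type*} [Field k] [Ring R] [Algebra k R] [Ring S] [Algebra k S]
    {D : Type*} [Category* D] [Preadditive D] [Linear k D] (X Y : D)
    (ρ : R ≃ₗ[k] (X ⟶ X)) (ρ_one : ρ 1 = 𝟙 X) (ρ_mul : ∀ a b, ρ (a * b) = ρ a ≫ ρ b)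
    (σ : S ≃ₗ[k] (Y ⟶ Y)) (σ_one : σ 1 = 𝟙 Y) (σ_mul : ∀ a b, σ (a * b) = σ a ≫ σ b) :
    BilinearContext k R S (X ⟶ Y) (Y ⟶ X) where
  rm := Linear.comp X X Y ∘ₗ ρ.toLinearMap
  ms := (Linear.comp X Y Y).compl₂ σ.toLinearMap
  sn := Linear.comp Y Y X ∘ₗ σ.toLinearMap
  nr := (Linear.comp Y X X).compl₂ ρ.toLinearMap
  mn := (Linear.comp X Y X).compr₂ ρ.symm.toLinearMap
  nm := (Linear.comp Y X Y).compr₂ σ.symm.toLinearMap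
  one_m m := by simp [ρ_one]
  m_one m := by simp [σ_one]
  one_n n := by simp [σ_one]
  n_one n := by simp [ρ_one]
  r_r_m r r' m := by simp [ρ_mul]
  r_m_s r m s := by simp
  m_s_s m s s' := by simp [σ_mul]
  s_s_n s s' n := by simp [σ_mul]
  s_n_r s n r := by simp
  n_r_r n r r' := by simp [ρ_mul]
  r_m_n r m n := ρ.injective (by simp [ρ_mul])
  m_s_n m s n := by simp
  m_n_r m n r := ρ.injective (by simp [ρ_mul])
  s_n_m s n m := σ.injective (by simp [σ_mul])
  n_r_m n r m := by simp
  n_m_s n m s := σ.injective (by simp [σ_mul])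
  m_n_m m n m' := by simp
  n_m_n n m n' := by simp

section RegularModule

universe u v w

open scoped ModuleCat.Algebra

variable (k : Type w) [Field k] (R : Type u) [Ring R] [Algebra k R]

/-- The regular left module of `R`, lifted to the universe used in `MoritaEquivalence`. It is not an
abbreviation, so that `k` acts on it as on every object of `ModuleCat R`, through `algebraMap k R`,
and not through the instances of `ULift`. -/
def regularModule : ModuleCat.{max u v} R := ModuleCat.of R (ULift.{v} R)

variable {R}

/-- The underlying module of `regularModule R` is `R`. -/
def regularModuleEquiv : R ≃ₗ[R] regularModule.{u, v} R := ULift.moduleEquiv.symm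

/-- The map from the regular module that sends `1` to `x`. -/
def regularModuleDesc {Z : ModuleCat.{max u v} R} (x : Z) : regularModule.{u, v} R ⟶ Z :=
  ModuleCat.ofHom (LinearMap.toSpanSingleton R Z x ∘ₗ regularModuleEquiv.symm.toLinearMap)

theorem regularModuleDesc_apply {Z : ModuleCat.{max u v} R} (x : Z) (r : R) :
    (regularModuleDesc.{u, v} x).hom (regularModuleEquiv r) = r • x :=
  congrArg (· • x) (regularModuleEquiv.{u, v}.symm_apply_apply r)

theorem regularModuleDesc_one {Z : ModuleCat.{max u v} R} (x : Z) :
    (regularModuleDesc.{u, v} x).hom (regularModuleEquiv 1) = x := by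
  rw [regularModuleDesc_apply, one_smul]

theorem regularModule_hom_ext {Z : ModuleCat.{max u v} R} {f g : regularModule.{u, v} R ⟶ Z}
    (h : f.hom (regularModuleEquiv 1) = g.hom (regularModuleEquiv 1)) : f = g := by
  refine ModuleCat.hom_ext (LinearMap.ext fun x => ?_)
  obtain ⟨r, rfl⟩ := regularModuleEquiv.surjective x
  rw [← mul_one r, ← smul_eq_mul, map_smul, map_smul, map_smul, h]

variable (R)

/-- Endomorphisms of the regular left module are right multiplications. Composition in diagrammatic
order corresponds to the product of `R`, so that no opposite ring is needed. -/
def regularModuleEnd : R ≃ₗ[k] (regularModule.{u, v} R ⟶ regularModule.{u, v} R) where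
  toFun r := regularModuleDesc (regularModuleEquiv r)
  invFun f := regularModuleEquiv.symm (f.hom (regularModuleEquiv 1))
  map_add' r r' := regularModule_hom_ext (by
    rw [ModuleCat.hom_add, LinearMap.add_apply]
    simp only [regularModuleDesc_one, map_add])
  map_smul' c r := regularModule_hom_ext (by
    rw [RingHom.id_apply, ModuleCat.hom_smul, LinearMap.smul_apply]
    simp only [regularModuleDesc_one]
    rw [← algebraMap_smul R c r, map_smul, algebraMap_smul])
  left_inv r :=
    (congrArg _ (regularModuleDesc_one _)).trans (regularModuleEquiv.{u, v}.symm_apply_apply r)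
  right_inv f := regularModule_hom_ext (by
    rw [regularModuleDesc_one, LinearEquiv.apply_symm_apply])

theorem regularModuleEnd_apply (r : R) :
    (regularModuleEnd.{u, v} k R r).hom (regularModuleEquiv 1) = regularModuleEquiv r :=
  regularModuleDesc_one _

theorem regularModuleEnd_one : regularModuleEnd.{u, v} k R 1 = 𝟙 _ :=
  regularModule_hom_ext (regularModuleEnd_apply k R 1)

theorem regularModuleEnd_mul (a b : R) :
    regularModuleEnd.{u, v} k R (a * b) = regularModuleEnd k R a ≫ regularModuleEnd k R b :=
  regularModule_hom_ext (by
    rw [ModuleCat.hom_comp, LinearMap.comp_apply, regularModuleEnd_apply, regularModuleEnd_apply]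
    exact (regularModuleEquiv.map_smul a b).trans (regularModuleDesc_apply _ a).symm)

variable {R}

/-- If the maps out of `Y` separate morphisms with source the regular module from zero, then the
trace ideal of `Y` is the whole ring: it is not contained in the kernel of a nonzero quotient map.
In other words the identity of the regular module is a sum of morphisms that factor through
`Y`. -/
theorem exists_sum_comp_eq_id_of_separating (Y : ModuleCat.{max u v} R)
    (hY : ∀ (Z : ModuleCat.{max u v} R) (f : regularModule.{u, v} R ⟶ Z),
      (∀ g : Y ⟶ regularModule.{u, v} R, g ≫ f = 0) → f = 0) :
    ∃ (t : ℕ) (m : Fin t → (regularModule.{u, v} R ⟶ Y)) (n : Fin t → (Y ⟶ regularModule.{u, v} R)),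
      ∑ i, m i ≫ n i = 𝟙 _ := by
  let I : Submodule R (regularModule.{u, v} R) :=
    ⨆ n : Y ⟶ regularModule.{u, v} R, LinearMap.range n.hom
  have hI : regularModuleEquiv 1 ∈ I := by
    have h0 := hY (ModuleCat.of R (regularModule.{u, v} R ⧸ I)) (ModuleCat.ofHom I.mkQ) fun g =>
      ModuleCat.hom_ext (LinearMap.ext fun y =>
        (Submodule.Quotient.mk_eq_zero I).2 (Submodule.mem_iSup_of_mem g ⟨y, rfl⟩))
    have h1 := congrArg (fun f => f.hom (regularModuleEquiv 1)) h0
    exact (Submodule.Quotient.mk_eq_zero I).1 h1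
  obtain ⟨x, hx, hsum⟩ := (Submodule.mem_iSup_iff_exists_finsupp _ _).1 hI
  choose y hy using hx
  refine ⟨x.support.card, fun i => regularModuleDesc (y (x.support.equivFin.symm i)),
    fun i => (x.support.equivFin.symm i).1, regularModule_hom_ext ?_⟩
  rw [Equiv.sum_comp x.support.equivFin.symm
    (fun i : x.support => regularModuleDesc (y i) ≫ (i : Y ⟶ regularModule.{u, v} R)),
    Finset.sum_coe_sort x.support
      (fun i : Y ⟶ regularModule.{u, v} R => regularModuleDesc (y i) ≫ i)]
  have hev : ∀ s : Finset (Y ⟶ regularModule.{u, v} R),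
      (∑ i ∈ s, regularModuleDesc.{u, v} (y i) ≫ i).hom (regularModuleEquiv 1) = ∑ i ∈ s, x i := by
    intro s
    rw [ModuleCat.hom_sum, LinearMap.sum_apply]
    refine Finset.sum_congr rfl fun i _ => ?_
    rw [ModuleCat.hom_comp, LinearMap.comp_apply, regularModuleDesc_one, hy]
  rw [hev]
  exact hsum

end RegularModule

section

universe u v w

open scoped ModuleCat.Algebra

variable {k : Type w} [Field k] {R : Type u} [Ring R] [Algebra k R] {S : Type v} [Ring S]
  [Algebra k S]

/-- Under an equivalence, the object corresponding to the regular module of `S` is a generator of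
the category of `R`-modules, so it has full trace ideal. -/
theorem CategoryTheory.Equivalence.exists_sum_comp_eq_id
    (e : ModuleCat.{max u v} R ≌ ModuleCat.{max u v} S) :
    ∃ (t : ℕ) (m : Fin t → (regularModule.{u, v} R ⟶ e.inverse.obj (regularModule.{v, u} S)))
      (n : Fin t → (e.inverse.obj (regularModule.{v, u} S) ⟶ regularModule.{u, v} R)),
      ∑ i, m i ≫ n i = 𝟙 _ := by
  refine exists_sum_comp_eq_id_of_separating _ fun Z f hf => ?_
  apply e.functor.map_injective
  rw [Functor.map_zero]
  refine ModuleCat.hom_ext (LinearMap.ext fun x => ?_)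
  let a : regularModule.{v, u} S ⟶ e.functor.obj (regularModule.{u, v} R) :=
    regularModuleDesc x
  have h1 := hf ((e.symm.toAdjunction.homEquiv _ _).symm a)
  have h2 : a ≫ e.functor.map f = 0 := by
    have := (e.symm.toAdjunction.homEquiv_naturality_right_symm a f)
    have h3 : (e.symm.toAdjunction.homEquiv _ _).symm (a ≫ e.functor.map f) = 0 := this.trans h1
    rw [Equiv.symm_apply_eq] at h3
    rw [h3, Adjunction.homEquiv_unit, Functor.map_zero, Limits.comp_zero]
  have h4 := congrArg (fun g => g.hom (regularModuleEquiv 1)) h2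
  have h5 : (e.functor.map f).hom (a.hom (regularModuleEquiv 1)) = 0 := h4
  rw [regularModuleDesc_one] at h5
  exact h5

/-- A Morita equivalence gives a context between `R` and `S` in which both products are onto. -/
theorem MoritaEquivalence.exists_bilinearContext (e : MoritaEquivalence k R S) :
    ∃ (M N : Type (max u v)) (_ : AddCommGroup M) (_ : Module k M) (_ : AddCommGroup N)
      (_ : Module k N) (C : BilinearContext k R S M N),
      (∃ (t : ℕ) (m : Fin t → M) (n : Fin t → N), ∑ i, C.mn (m i) (n i) = 1) ∧
      ∃ (t : ℕ) (n : Fin t → N) (m : Fin t → M), ∑ i, C.nm (n i) (m i) = 1 := by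
  let X := regularModule.{u, v} R
  let Y := e.eqv.inverse.obj (regularModule.{v, u} S)
  have hbij : Function.Bijective
      (e.eqv.inverse.mapLinearMap k (X := regularModule.{v, u} S) (Y := regularModule.{v, u} S)) :=
    ⟨e.eqv.inverse.map_injective, e.eqv.inverse.map_surjective⟩
  let σ : S ≃ₗ[k] (Y ⟶ Y) := (regularModuleEnd.{v, u} k S).trans
    (LinearEquiv.ofBijective (e.eqv.inverse.mapLinearMap k) hbij)
  have hσ : ∀ s, σ s = e.eqv.inverse.map (regularModuleEnd k S s) := fun _ => rfl
  let C := BilinearContext.ofHom X Y (regularModuleEnd k R) (regularModuleEnd_one k R)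
    (regularModuleEnd_mul k R) σ (by rw [hσ, regularModuleEnd_one, CategoryTheory.Functor.map_id])
    (fun a b => by rw [hσ, regularModuleEnd_mul, Functor.map_comp, hσ, hσ])
  refine ⟨X ⟶ Y, Y ⟶ X, inferInstance, inferInstance, inferInstance, inferInstance, C, ?_, ?_⟩
  · obtain ⟨t, m, n, h⟩ := e.eqv.exists_sum_comp_eq_id
    refine ⟨t, m, n, (regularModuleEnd k R).injective ?_⟩
    rw [map_sum, regularModuleEnd_one, ← h]
    exact Finset.sum_congr rfl fun i _ => LinearEquiv.apply_symm_apply _ _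
  · obtain ⟨t, n, m, h⟩ := e.eqv.symm.exists_sum_comp_eq_id
    refine ⟨t, fun i => e.eqv.inverse.map (n i) ≫ e.eqv.unitIso.inv.app X,
      fun i => e.eqv.unitIso.hom.app X ≫ e.eqv.inverse.map (m i), σ.injective ?_⟩
    rw [map_sum, hσ 1, regularModuleEnd_one, ← h, Functor.map_sum]
    refine Finset.sum_congr rfl fun i _ => (LinearEquiv.apply_symm_apply _ _).trans ?_
    simp [← Functor.map_comp]

end

end MoritaEquivalence

theorem theorem7p5 {k R S : Type*} [Field k] [CharZero k] [Ring R] [Algebra k R]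
    [Ring S] [Algebra k S] (hR : IsPrimeRing R) (hR' : IsGoldie R)
    (hS : IsPrimeRing S) (hS' : IsGoldie S) :
    (∀ (V W : Type*)
        [AddCommGroup V] [Module k V] [Module R V] [Module Sᵐᵒᵖ V] [SMulCommClass R Sᵐᵒᵖ V]
        [IsScalarTower k R V] [IsScalarTower k Sᵐᵒᵖ V]
        [AddCommGroup W] [Module k W] [Module S W] [Module Rᵐᵒᵖ W] [SMulCommClass S Rᵐᵒᵖ W]
        [IsScalarTower k S W] [IsScalarTower k Rᵐᵒᵖ W] (C : MoritaContext k R S V W),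
        C.IsPrime → lowerTrdeg k R = lowerTrdeg k S) ∧
    (IsMoritaEquivalent k R S →
        lowerTrdeg k R = lowerTrdeg k S ∧ gkDim k R = gkDim k S ∧
          (IsLDStable k R ↔ IsLDStable k S)) := by
  refine ⟨?_, fun ⟨⟨e⟩⟩ => ?_⟩
  · intros
    rename_i C hC
    exact hC.nondegenerate.lowerTrdeg_eq hR hR' hS hS'
  · obtain ⟨M, N, _, _, _, _, C, ⟨p, m, n, hmn⟩, ⟨q, n', m', hnm⟩⟩ := e.exists_bilinearContext
    have := hR.nontrivial
    have := hS.nontrivial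
    have hLD := (BilinearContext.nondegenerate_of_sum_eq_one m n hmn n' m' hnm).lowerTrdeg_eq
      hR hR' hS hS'
    have hGK : gkDim k R = gkDim k S :=
      le_antisymm (C.gkDim_le m n hmn) (C.swap.gkDim_le n' m' hnm)
    exact ⟨hLD, hGK, by rw [IsLDStable, IsLDStable, hLD, hGK]⟩
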